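/- **Definitions.** Let $\Sigma_I,\Sigma_O$ be nonempty finite alphabets and $L\subseteq(\Sigma_I\times\Sigma_O)^\omega$. For a delay function $f:\mathbb N\to\mathbb N_+$, the delay game $\Gamma_f(L)$ is played in rounds $i=0,1,2,\dots$: in round $i$ Player $I$ picks a word $u_i\in\Sigma_I^{f(i)}$, then Player $O$ picks a letter $v_i\in\Sigma_O$. With $\alpha=u_0u_1u_2\cdots$ and $\beta=v_0v_1v_2\cdots$, Player $O$ wins the play if its outcome $\binom{\alpha(0)}{\beta(0)}\binom{\alpha(1)}{\beta(1)}\cdots$ is in $L$; otherwise Player $I$ wins. The following strategies do not depend on $f$. * A lookahead-counting (l.c.) strategy for Player $I$ is a map $\tau:\Sigma_O^*\times\mathbb N\to\Sigma_I^\omega$; a play of $\Gamma_f(L)$ is consistent with $\tau$ if, for every $i$, $u_i$ is the prefix of length $f(i)$ of $\tau(v_0\cdots v_{i-1},\sum_{j<i}f(j))$. * An input-output-tracking (i.o.t.) strategy for Player $I$ is a map $\tau:\Sigma_O^*\times\Sigma_I^*\to\Sigma_I^\omega$; consistency: $u_i$ is the prefix of length $f(i)$ of $\tau(v_0\cdots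 v_{i-1},u_0\cdots u_{i-1})$ for every $i$. * A history-tracking (h.t.) strategy for Player $I$ is a map $\tau:\Sigma_O^*\times(\mathbb N_+)^*\to\Sigma_I^\omega$; consistency: $u_i$ is the prefix of length $f(i)$ of $\tau(v_0\cdots v_{i-1},f(0)\cdots f(i-1))$ for every $i$. * A round-counting (r.c.) strategy for Player $O$ is a map $\sigma:\Sigma_I^*\times\mathbb N\to\Sigma_O$; consistency: $v_i=\sigma(u_0\cdots u_i,i)$ for every $i$. A strategy is omnipotent for $L$ if, for every delay function $f$, its owner wins every play of $\Gamma_f(L)$ that is consistent with it. A nondeterministic $\omega$-pushdown automaton $\mathcal A$ is a nondeterministic pushdown automaton (with $\varepsilon$-moves) with finite nonempty input alphabet, state set $Q$ and stack alphabet, an initial state, an initial stack symbol, finitely many transitions, and a family $\mathcal F\subseteq 2^Q$. A run on an infinite word is an infinite sequence of consecutive configurations, starting in the initial state with only the initial symbol on the stack, during which the whole word is read. An infinite word belongs to $L(\mathcal A)$ if there is a run on it such that the set $\mathrm{Inf}$ of states visited infinitely often satisfies $\mathrm{Inf}\cap H\neq\emptyset$ for some $H\in\mathcal F$ (Büchi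 acceptance), respectively $\mathrm{Inf}\in\mathcal F$ (Muller acceptance). **Theorem.** For Büchi acceptance as well as for Muller acceptance, each of the following four problems is undecidable, where the input is (a finite description of) nonempty finite alphabets $\Sigma_I,\Sigma_O$ and a nondeterministic $\omega$-pushdown automaton $\mathcal A$ over the alphabet $\Sigma_I\times\Sigma_O$: 1. Does Player $I$ have an omnipotent l.c. strategy for $L(\mathcal A)$? 2. Does Player $I$ have an omnipotent i.o.t. strategy for $L(\mathcal A)$? 3. Does Player $I$ have an omnipotent h.t. strategy for $L(\mathcal A)$? 4. Does Player $O$ have an omnipotent r.c. strategy for $L(\mathcal A)$? -/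

import Mathlib

namespace DelayGames

/-! ### ω-pushdown automata -/

/-- An `ω`-pushdown automaton (nondeterministic, with `ε`-moves) with input alphabet `A`,
state set `Q` and stack alphabet `Γ`. It is used below for finite nonempty `A`, `Q`, `Γ` only.
A transition `(q, a, X, q', w)` may be taken in state `q` with topmost stack symbol `X`; it reads
the letter `a` (nothing if `a = none`), enters state `q'` and replaces `X` by the word `w`, whose
first symbol becomes the topmost one. `acc` is the family of designated sets of states. -/
structure OmegaPDA (A Q Γ : Type) where
  start : Q
  bottom : Γ
  trans : List (Q × Option A × Γ × Q × List Γ)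
  acc : Set (Set Q)

namespace OmegaPDA

variable {A Q Γ : Type}

/-- `(q 0, s 0), (q 1, s 1), …` is a complete run on the infinite word `α`: the `i`-th
configuration has state `q i`, stack `s i` (topmost symbol first), and `p i` letters of `α` have
been read when it is reached. Completeness means that the whole word `α` is read. -/
structure IsRun (M : OmegaPDA A Q Γ) (α : ℕ → A) (q : ℕ → Q) (s : ℕ → List Γ) (p : ℕ → ℕ) :
    Prop where
  init_state : q 0 = M.start
  init_stack : s 0 = [M.bottom]
  init_pos : p 0 = 0
  step : ∀ i, ∃ (a : Option A) (X : Γ) (w rest : List Γ),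
    (q i, a, X, q (i + 1), w) ∈ M.trans ∧ s i = X :: rest ∧ s (i + 1) = w ++ rest ∧
      ((a = none ∧ p (i + 1) = p i) ∨ (a = some (α (p i)) ∧ p (i + 1) = p i + 1))
  complete : ∀ n, ∃ i, n ≤ p i

/-- The set of states that occur infinitely often in a sequence of states. -/
def infStates (q : ℕ → Q) : Set Q := {x | ∀ n, ∃ i, n ≤ i ∧ q i = x}

end OmegaPDA

/-- Acceptance modes for `ω`-pushdown automata. -/
inductive AccMode
  | buchi
  | muller

/-- A sequence of states satisfies the acceptance condition given by the family `acc` of sets of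
states: some state of some designated set occurs infinitely often (Büchi), respectively the set of
states occurring infinitely often is a designated set (Muller). -/
def AccMode.Accepts {Q : Type} (acc : Set (Set Q)) (q : ℕ → Q) : AccMode → Prop
  | .buchi => ∃ H ∈ acc, (OmegaPDA.infStates q ∩ H).Nonempty
  | .muller => OmegaPDA.infStates q ∈ acc

/-- The `ω`-language recognized by an `ω`-pushdown automaton. -/
def OmegaPDA.language {A Q Γ : Type} (M : OmegaPDA A Q Γ) (m : AccMode) : Set (ℕ → A) :=
  {α | ∃ q s p, M.IsRun α q s p ∧ m.Accepts M.acc q}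

/-! ### Automata as finite inputs of a decision problem -/

/-- A finite description of an `ω`-pushdown automaton over a product alphabet `Σ_I × Σ_O`:
the alphabets have `lettersI + 1` and `lettersO + 1` letters, there are `states + 1` states and
`stackSyms + 1` stack symbols, and everything is listed explicitly by numbers. -/
structure PDACode where
  lettersI : ℕ
  lettersO : ℕ
  states : ℕ
  stackSyms : ℕ
  start : ℕ
  bottom : ℕ
  trans : List (ℕ × Option (ℕ × ℕ) × ℕ × ℕ × List ℕ)
  acc : List (List ℕ)

namespace PDACode

/-- A description is the tuple of its entries. -/
def equivTuple : PDACode ≃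
    ℕ × ℕ × ℕ × ℕ × ℕ × ℕ × List (ℕ × Option (ℕ × ℕ) × ℕ × ℕ × List ℕ) × List (List ℕ) where
  toFun c := (c.lettersI, c.lettersO, c.states, c.stackSyms, c.start, c.bottom, c.trans, c.acc)
  invFun t := ⟨t.1, t.2.1, t.2.2.1, t.2.2.2.1, t.2.2.2.2.1, t.2.2.2.2.2.1, t.2.2.2.2.2.2.1,
    t.2.2.2.2.2.2.2⟩
  left_inv _ := rfl
  right_inv _ := rfl

instance : Primcodable PDACode := Primcodable.ofEquiv _ equivTuple

/-- The input player's alphabet. -/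
abbrev SigmaI (c : PDACode) : Type := Fin (c.lettersI + 1)

/-- The output player's alphabet. -/
abbrev SigmaO (c : PDACode) : Type := Fin (c.lettersO + 1)

/-- The automaton described by `c`. A number `x` stands for the element `x` of `Fin (n + 1)`;
numbers that are out of range are reduced modulo `n + 1`, so that every description is one of an
automaton (and every automaton with these finite sets has a description). -/
def toPDA (c : PDACode) :
    OmegaPDA (c.SigmaI × c.SigmaO) (Fin (c.states + 1)) (Fin (c.stackSyms + 1)) where
  start := Fin.ofNat _ c.start
  bottom := Fin.ofNat _ c.bottom
  trans := c.trans.map fun t =>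
    (Fin.ofNat _ t.1, t.2.1.map fun a => (Fin.ofNat _ a.1, Fin.ofNat _ a.2),
      Fin.ofNat _ t.2.2.1, Fin.ofNat _ t.2.2.2.1, t.2.2.2.2.map fun X => Fin.ofNat _ X)
  acc := {H | ∃ l ∈ c.acc, H = {x | ∃ y ∈ l, Fin.ofNat _ y = x}}

/-- The winning condition `L(𝒜) ⊆ (Σ_I × Σ_O)^ω` recognized by the described automaton. -/
def language (c : PDACode) (m : AccMode) : Set (ℕ → c.SigmaI × c.SigmaO) :=
  c.toPDA.language m

end PDACode

/-! ### Delay games -/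

section Games

variable {I O : Type}

/-- The finite word `w 0 ⋯ w (n - 1)` of the first `n` letters of an infinite word. -/
def wordPrefix {X : Type} (w : ℕ → X) (n : ℕ) : List X := (List.range n).map w

/-- A play `(u 0, v 0) (u 1, v 1) ⋯` of the delay game with respect to the delay function `f`: in
round `i` Player `I` picks a word `u i` of `f i` letters, then Player `O` picks a letter `v i`. -/
structure Play (I O : Type) (f : ℕ → ℕ+) where
  u : ℕ → List I
  v : ℕ → O
  length_u : ∀ i, (u i).length = f i

namespace Play

variable {f : ℕ → ℕ+}

/-- The concatenation `u 0 ⋯ u (i - 1)` of the first `i` moves of Player `I`. -/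
def movesI (ρ : Play I O f) (i : ℕ) : List I := (List.range i).flatMap ρ.u

/-- The concatenation `v 0 ⋯ v (i - 1)` of the first `i` moves of Player `O`. -/
def movesO (ρ : Play I O f) (i : ℕ) : List O := wordPrefix ρ.v i

theorem le_length_movesI (ρ : Play I O f) (i : ℕ) : i ≤ (ρ.movesI i).length := by
  induction i with
  | zero => simp
  | succ k ih =>
    have h1 : ρ.movesI (k + 1) = ρ.movesI k ++ ρ.u k := by
      simp [movesI, List.range_succ]
    have h2 : 0 < (ρ.u k).length := by rw [ρ.length_u]; exact (f k).pos
    rw [h1, List.length_append]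
    omega

/-- The infinite word `u 0 u 1 u 2 ⋯` produced by Player `I`: its letter at position `n` is found
in `u 0 ⋯ u n`, which has more than `n` letters. -/
def alpha (ρ : Play I O f) (n : ℕ) : I := (ρ.movesI (n + 1))[n]'(ρ.le_length_movesI (n + 1))

/-- The outcome of a play, an infinite word over `Σ_I × Σ_O`. -/
def outcome (ρ : Play I O f) (n : ℕ) : I × O := (ρ.alpha n, ρ.v n)

end Play

/-- Player `I` has an omnipotent lookahead-counting strategy for `L`. -/
def HasOmnipotentLC (L : Set (ℕ → I × O)) : Prop :=
  ∃ τ : List O × ℕ → (ℕ → I), ∀ (f : ℕ → ℕ+) (ρ : Play I O f),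
    (∀ i, ρ.u i = wordPrefix (τ (ρ.movesO i, ∑ j ∈ Finset.range i, (f j : ℕ))) (f i)) →
      ρ.outcome ∉ L

/-- Player `I` has an omnipotent input-output-tracking strategy for `L`. -/
def HasOmnipotentIOT (L : Set (ℕ → I × O)) : Prop :=
  ∃ τ : List O × List I → (ℕ → I), ∀ (f : ℕ → ℕ+) (ρ : Play I O f),
    (∀ i, ρ.u i = wordPrefix (τ (ρ.movesO i, ρ.movesI i)) (f i)) → ρ.outcome ∉ L

/-- Player `I` has an omnipotent history-tracking strategy for `L`. -/
def HasOmnipotentHT (L : Set (ℕ → I × O)) : Prop :=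
  ∃ τ : List O × List ℕ+ → (ℕ → I), ∀ (f : ℕ → ℕ+) (ρ : Play I O f),
    (∀ i, ρ.u i = wordPrefix (τ (ρ.movesO i, wordPrefix f i)) (f i)) → ρ.outcome ∉ L

/-- Player `O` has an omnipotent round-counting strategy for `L`. -/
def HasOmnipotentRC (L : Set (ℕ → I × O)) : Prop :=
  ∃ σ : List I × ℕ → O, ∀ (f : ℕ → ℕ+) (ρ : Play I O f),
    (∀ i, ρ.v i = σ (ρ.movesI (i + 1), i)) → ρ.outcome ∈ L

end Games

end DelayGames

/-! If `Σ_O` has a single letter, Player `O` has no choices. Player `I` can then fix any word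
outside `L` and continue it wherever she stands, so each of her three kinds of omnipotent strategy
exists iff `L ≠ Set.univ`, while Player `O` has one iff `L = Set.univ`. It remains to show that
universality is undecidable.

Halting reduces to universality. Take a machine with several stacks; an infinite word is read as a
sequence of claims about the symbols it observes. A pushdown automaton guesses one stack, maintains
it while believing the claims about all other stacks, and accepts once a claim about its own stack
is false or the program halts. A word escapes every guess iff all claims are true and the program
never halts; hence the language is universal iff the program halts (`forall_exists_trackRun_iff`,
`language_pda_eq_univ_iff`). Acceptance means staying forever in one sink state, so Büchi and Muller
acceptance agree.

The machine is a fixed universal one; its input affects only the initial stack, that is, one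
transition (`exists_computable_pdaCode`). -/

namespace DelayGames

/-! ### Delay games with a single output letter -/

section TrivialOutput

variable {I O : Type}

theorem wordPrefix_add {X : Type} (w : ℕ → X) (m n : ℕ) :
    wordPrefix w (m + n) = wordPrefix w m ++ wordPrefix (fun i => w (m + i)) n := by
  simp [wordPrefix, List.range_add, Function.comp_def]

namespace Play

variable {f : ℕ → ℕ+}

theorem movesI_succ (ρ : Play I O f) (i : ℕ) : ρ.movesI (i + 1) = ρ.movesI i ++ ρ.u i := by
  simp [movesI, List.range_succ]

theorem length_movesI (ρ : Play I O f) (i : ℕ) :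
    (ρ.movesI i).length = ∑ j ∈ Finset.range i, (f j : ℕ) := by
  induction i with
  | zero => simp [movesI]
  | succ i ih => rw [movesI_succ, List.length_append, ih, ρ.length_u, Finset.sum_range_succ]

theorem alpha_eq_of_movesI (ρ : Play I O f) (α : ℕ → I)
    (h : ∀ i, ρ.movesI i = wordPrefix α (∑ j ∈ Finset.range i, (f j : ℕ))) : ρ.alpha = α := by
  funext n
  simp [alpha, h, wordPrefix]

/-- If Player `I` always continues a fixed infinite word, then this is the word produced. -/
theorem alpha_eq_of_u (ρ : Play I O f) (α : ℕ → I)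
    (h : ∀ i, ρ.u i =
      wordPrefix (fun n => α ((∑ j ∈ Finset.range i, (f j : ℕ)) + n)) (f i)) : ρ.alpha = α := by
  refine ρ.alpha_eq_of_movesI α fun i => ?_
  induction i with
  | zero => simp [movesI, wordPrefix]
  | succ i ih => rw [movesI_succ, ih, h, Finset.sum_range_succ, wordPrefix_add]

end Play

theorem HasOmnipotentLC.iot {L : Set (ℕ → I × O)} : HasOmnipotentLC L → HasOmnipotentIOT L := by
  rintro ⟨τ, hτ⟩
  refine ⟨fun x => τ (x.1, x.2.length), fun f ρ h => hτ f ρ fun i => ?_⟩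
  simp only [h, ρ.length_movesI]

/-- The lookahead count is the sum of the recorded values of `f`. -/
theorem HasOmnipotentLC.ht {L : Set (ℕ → I × O)} : HasOmnipotentLC L → HasOmnipotentHT L := by
  rintro ⟨τ, hτ⟩
  refine ⟨fun x => τ (x.1, (x.2.map fun a : ℕ+ => (a : ℕ)).sum), fun f ρ h => hτ f ρ fun i => ?_⟩
  rw [h, Finset.sum_range, List.sum_ofFn.symm, List.ofFn_eq_map]
  simp [wordPrefix, Function.comp_def, ← List.map_coe_finRange_eq_range]

/-- The moves of Player `I` in the game without lookahead when her next letter is determined by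
the number of rounds and her previous moves. -/
def letterMoves (g : ℕ → List I → I) : ℕ → List I
  | 0 => []
  | i + 1 => letterMoves g i ++ [g i (letterMoves g i)]

/-- The play of the game without lookahead that is given by `g` and `v`. -/
def letterPlay (g : ℕ → List I → I) (v : ℕ → O) : Play I O (fun _ => 1) where
  u i := [g i (letterMoves g i)]
  v := v
  length_u _ := rfl

theorem movesI_letterPlay (g : ℕ → List I → I) (v : ℕ → O) (i : ℕ) :
    (letterPlay g v).movesI i = letterMoves g i := by
  induction i with
  | zero => rfl
  | succ i ih => rw [Play.movesI_succ, ih]; rfl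

/-- A strategy only has to have some consistent play; the game without lookahead provides one. -/
theorem HasOmnipotentIOT.ne_univ [Inhabited O] {L : Set (ℕ → I × O)} (h : HasOmnipotentIOT L) :
    L ≠ Set.univ := by
  rintro rfl
  obtain ⟨τ, hτ⟩ := h
  let g : ℕ → List I → I := fun i l => τ (wordPrefix (fun _ => default) i, l) 0
  refine hτ _ (letterPlay g fun _ => default) (fun i => ?_) trivial
  rw [movesI_letterPlay]
  rfl

theorem HasOmnipotentHT.ne_univ [Inhabited O] {L : Set (ℕ → I × O)} (h : HasOmnipotentHT L) :
    L ≠ Set.univ := by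
  rintro rfl
  obtain ⟨τ, hτ⟩ := h
  let g : ℕ → List I → I := fun i _ =>
    τ (wordPrefix (fun _ => default) i, wordPrefix (fun _ => 1) i) 0
  exact hτ _ (letterPlay g fun _ => default) (fun i => rfl) trivial

/-- The lookahead count is exactly the position at which the losing word `w` has to be continued. -/
theorem hasOmnipotentLC_of_ne_univ [Unique O] {L : Set (ℕ → I × O)} (h : L ≠ Set.univ) :
    HasOmnipotentLC L := by
  obtain ⟨w, hw⟩ := (Set.ne_univ_iff_exists_notMem L).1 h
  refine ⟨fun x n => (w (x.2 + n)).1, fun f ρ hρ => ?_⟩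
  have : ρ.outcome = w := by
    funext n
    exact Prod.ext (congrFun (ρ.alpha_eq_of_u (fun n => (w n).1) hρ) n) (Subsingleton.elim _ _)
  rwa [this]

theorem hasOmnipotentLC_iff [Unique O] {L : Set (ℕ → I × O)} :
    HasOmnipotentLC L ↔ L ≠ Set.univ :=
  ⟨fun h => h.iot.ne_univ, hasOmnipotentLC_of_ne_univ⟩

theorem hasOmnipotentIOT_iff [Unique O] {L : Set (ℕ → I × O)} :
    HasOmnipotentIOT L ↔ L ≠ Set.univ :=
  ⟨fun h => h.ne_univ, fun h => (hasOmnipotentLC_of_ne_univ h).iot⟩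

theorem hasOmnipotentHT_iff [Unique O] {L : Set (ℕ → I × O)} :
    HasOmnipotentHT L ↔ L ≠ Set.univ :=
  ⟨fun h => h.ne_univ, fun h => (hasOmnipotentLC_of_ne_univ h).ht⟩

theorem hasOmnipotentRC_iff [Unique O] {L : Set (ℕ → I × O)} :
    HasOmnipotentRC L ↔ L = Set.univ := by
  constructor
  · rintro ⟨σ, hσ⟩
    refine Set.eq_univ_of_forall fun w => ?_
    let ρ := letterPlay (O := O) (fun i _ => (w i).1) fun _ => default
    have : ρ.outcome = w := by
      funext n
      refine Prod.ext (congrFun (ρ.alpha_eq_of_u (fun n => (w n).1) fun i => ?_) n)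
        (Subsingleton.elim _ _)
      simp [ρ, letterPlay, wordPrefix]
    rw [← this]
    exact hσ _ ρ fun i => Subsingleton.elim _ _
  · rintro rfl
    exact ⟨fun _ => default, fun _ _ _ => trivial⟩

end TrivialOutput

/-! ### Programs on several stacks and the refutation of claims about them -/

/-- A deterministic program that works on stacks indexed by `K`. At a control point it halts, or
it observes the topmost symbol of one stack (`none` if it is empty), moves to a new control point
and replaces the observed symbol by a word, both depending on the observation. -/
abbrev StackProgram (C K Γ : Type) : Type := C → Option (K × (Option Γ → C × List Γ))

namespace StackProgram

variable {C K Γ : Type} [DecidableEq K]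

/-- One step of a program on configurations. -/
def step (P : StackProgram C K Γ) (x : C × (K → List Γ)) : Option (C × (K → List Γ)) :=
  (P x.1).map fun r =>
    ((r.2 (x.2 r.1).head?).1,
      Function.update x.2 r.1 ((r.2 (x.2 r.1).head?).2 ++ (x.2 r.1).tail))

/-- The configuration reached after `i` steps; a program that has halted does not move. -/
def run (P : StackProgram C K Γ) (x : C × (K → List Γ)) : ℕ → C × (K → List Γ)
  | 0 => x
  | i + 1 => (P.step (P.run x i)).getD (P.run x i)

theorem step_eq_none_iff {P : StackProgram C K Γ} {x : C × (K → List Γ)} :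
    P.step x = none ↔ P x.1 = none := by
  simp [step]

theorem eval_step_dom_iff (P : StackProgram C K Γ) (x : C × (K → List Γ)) :
    (StateTransition.eval P.step x).Dom ↔ ∃ i, P (P.run x i).1 = none := by
  simp only [← step_eq_none_iff]
  rw [Part.dom_iff_mem]
  simp only [StateTransition.mem_eval]
  constructor
  · rintro ⟨y, hxy, hy⟩
    suffices ∃ i, P.run x i = y by
      obtain ⟨i, rfl⟩ := this
      exact ⟨i, hy⟩
    clear hy
    induction hxy with
    | refl => exact ⟨0, rfl⟩
    | tail _ h ih =>
      obtain ⟨i, rfl⟩ := ih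
      exact ⟨i + 1, by rw [run, Option.mem_def.1 h]; rfl⟩
  · rintro ⟨i, hi⟩
    refine ⟨_, ?_, hi⟩
    clear hi
    induction i with
    | zero => exact .refl
    | succ i ih =>
      rw [run]
      cases h : P.step (P.run x i) with
      | none => exact ih
      | some y => exact ih.tail h

/-- The stack symbols of a stack, with a bottom marker. -/
def marked (l : List Γ) : List (Option Γ) := l.map some ++ [none]

variable [DecidableEq Γ]

/-- The transition function of a pushdown automaton that checks claims (its input letters) about
the observations of a program. It keeps track of the control point reached according to the claims
and of a single stack. Having detected a false claim about this stack, or that the program halts,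
it enters the state `none` forever. -/
def track (P : StackProgram C K Γ) :
    Option (K × C) → Option Γ → Option Γ → Option (K × C) × List (Option Γ)
  | none, _, t => (none, [t])
  | some (k, c), s, t =>
    match P c with
    | none => (none, [t])
    | some (k', f) =>
      if k' = k then
        if t = s then
          (some (k, (f s).1), (f s).2.map some ++ if s = none then [none] else [])
        else (none, [t])
      else (some (k, (f s).1), [t])

/-- The action of `track` on configurations. -/
def trackStep (P : StackProgram C K Γ) (s : Option Γ) :
    Option (K × C) × List (Option Γ) → Option (K × C) × List (Option Γ)
  | (q, []) => (q, [])
  | (q, t :: r) => ((P.track q s t).1, (P.track q s t).2 ++ r)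

/-- The run that keeps track of the stack `k`. -/
def trackRun (P : StackProgram C K Γ) (x : C × (K → List Γ)) (w : ℕ → Option Γ) (k : K) :
    ℕ → Option (K × C) × List (Option Γ)
  | 0 => (some (k, x.1), marked (x.2 k))
  | i + 1 => P.trackStep (w i) (P.trackRun x w k i)

/-- The bottom marker is put back whenever it is observed, so the tracking run never blocks on an
empty stack. -/
theorem none_mem_trackRun (P : StackProgram C K Γ) (x : C × (K → List Γ)) (w : ℕ → Option Γ)
    (k : K) (i : ℕ) : none ∈ (P.trackRun x w k i).2 := by
  induction i with
  | zero => simp [trackRun, marked]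
  | succ i ih =>
    rw [trackRun]
    rcases e : P.trackRun x w k i with ⟨q, _ | ⟨t, r⟩⟩ <;> rw [e] at ih
    · exact ih
    · rcases List.mem_cons.1 ih with rfl | h
      · refine List.mem_append_left _ ?_
        rcases q with _ | ⟨k', c⟩
        · simp [track]
        · simp only [track]
          rcases P c with _ | ⟨k'', f⟩
          · simp
          · by_cases h1 : k'' = k' <;> by_cases h2 : w i = none <;> simp [h1, h2, eq_comm]
      · exact List.mem_append_right _ h

theorem trackRun_eq_cons (P : StackProgram C K Γ) (x : C × (K → List Γ)) (w : ℕ → Option Γ)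
    (k : K) (i : ℕ) : ∃ t r, P.trackRun x w k i = ((P.trackRun x w k i).1, t :: r) := by
  have h := P.none_mem_trackRun x w k i
  rcases e : P.trackRun x w k i with ⟨q, _ | ⟨t, r⟩⟩
  · simp [e] at h
  · exact ⟨t, r, rfl⟩

theorem trackRun_of_le (P : StackProgram C K Γ) (x : C × (K → List Γ)) (w : ℕ → Option Γ)
    (k : K) {i j : ℕ} (hij : i ≤ j) (hi : (P.trackRun x w k i).1 = none) :
    (P.trackRun x w k j).1 = none := by
  induction j, hij using Nat.le_induction with
  | base => exact hi
  | succ j _ ih =>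
    rw [trackRun]
    rcases e : P.trackRun x w k j with ⟨q, _ | ⟨t, r⟩⟩ <;> rw [e] at ih <;> subst ih <;> rfl

/-- The configuration of the automaton tracking the stack `k` that belongs to a configuration of
the program. -/
def tracked (x : C × (K → List Γ)) (k : K) : Option (K × C) × List (Option Γ) :=
  (some (k, x.1), marked (x.2 k))

theorem trackStep_tracked_of_halt {P : StackProgram C K Γ} {x : C × (K → List Γ)} (k : K)
    (s : Option Γ) (h : P x.1 = none) : (P.trackStep s (tracked x k)).1 = none := by
  rcases e : x.2 k with _ | ⟨t, r⟩ <;> simp [tracked, e, marked, trackStep, track, h]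

theorem trackStep_tracked_of_false {P : StackProgram C K Γ} {x : C × (K → List Γ)} {k : K}
    {f : Option Γ → C × List Γ} {s : Option Γ} (h : P x.1 = some (k, f))
    (hs : s ≠ (x.2 k).head?) : (P.trackStep s (tracked x k)).1 = none := by
  rcases e : x.2 k with _ | ⟨t, r⟩ <;> rw [e] at hs
  · simp [tracked, e, marked, trackStep, track, h, show none ≠ s from Ne.symm hs]
  · simp [tracked, e, marked, trackStep, track, h, show some t ≠ s from Ne.symm hs]

/-- The trackers of the other stacks take the next control point from the claim, so a true claim
keeps all of them in step with the program. -/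
theorem trackStep_tracked_of_true {P : StackProgram C K Γ} {x : C × (K → List Γ)} {k : K}
    {f : Option Γ → C × List Γ} (h : P x.1 = some (k, f)) (k' : K) :
    P.trackStep (x.2 k).head? (tracked x k') = tracked ((P.step x).getD x) k' := by
  by_cases hk : k = k'
  · subst hk
    rcases e : x.2 k with _ | ⟨t, r⟩ <;> simp [tracked, e, marked, trackStep, track, h, step]
  · rcases e : x.2 k' with _ | ⟨t, r⟩ <;>
      simp [tracked, e, marked, trackStep, track, h, step, hk, Ne.symm hk]

/-- Every infinite sequence of claims is refuted on some stack if and only if the program halts. -/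
theorem forall_exists_trackRun_iff [Nonempty K] (P : StackProgram C K Γ)
    (x : C × (K → List Γ)) :
    (∀ w, ∃ k i, (P.trackRun x w k i).1 = none) ↔ (StateTransition.eval P.step x).Dom := by
  rw [eval_step_dom_iff]
  constructor
  · intro h
    by_contra! hP
    choose r hr using fun i => Option.ne_none_iff_exists'.1 (hP i)
    -- These are the truthful claims along the nonhalting run; no tracker can refute them.
    let w : ℕ → Option Γ := fun i => ((P.run x i).2 (r i).1).head?
    have key : ∀ k i, P.trackRun x w k i = tracked (P.run x i) k := by
      intro k i
      induction i with
      | zero => rfl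
      | succ i ih => rw [trackRun, ih, run, trackStep_tracked_of_true (hr i)]
    obtain ⟨k, i, hki⟩ := h w
    rw [key] at hki
    simp [tracked] at hki
  · rintro ⟨i, hi⟩ w
    by_contra! hw
    -- All stacks are treated simultaneously: a false claim at time `j` is caught by the tracker of
    -- the stack observed then, which need not be `k`.
    have key : ∀ j k, P.trackRun x w k j = tracked (P.run x j) k := by
      intro j
      induction j with
      | zero => exact fun k => rfl
      | succ j ih =>
        intro k
        rw [trackRun, ih, run]
        rcases e : P (P.run x j).1 with _ | ⟨k', f⟩
        · exact absurd (by rw [trackRun, ih, trackStep_tracked_of_halt k _ e]) (hw k (j + 1))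
        · by_cases hs : w j = ((P.run x j).2 k').head?
          · rw [hs, trackStep_tracked_of_true e]
          · exact absurd (by rw [trackRun, ih, trackStep_tracked_of_false e hs])
              (hw k' (j + 1))
    obtain ⟨k⟩ := ‹Nonempty K›
    exact hw k (i + 1) (by rw [trackRun, key, trackStep_tracked_of_halt k _ hi])

/-! ### The pushdown automaton that guesses a stack -/

variable [Fintype C] [Fintype K] [Fintype Γ]

/-- The transitions of `pda` that do not depend on the input of the program. -/
noncomputable def fixedTrans (P : StackProgram C K Γ) (c : C) (k₀ : K) :
    List (Option (Option (K × C)) × Option (Option Γ) × Option Γ ×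
      Option (Option (K × C)) × List (Option Γ)) :=
  ((Finset.univ.erase k₀).toList.map fun k => (none, none, none, some (some (k, c)), [none])) ++
    (Finset.univ : Finset (Option (K × C) × Option Γ × Option Γ)).toList.map fun z =>
      (some z.1, some z.2.1, z.2.2, some (P.track z.1 z.2.1 z.2.2).1,
        (P.track z.1 z.2.1 z.2.2).2)

/-- The pushdown automaton that guesses a stack and keeps track of it. Initially the stack `k₀`
contains `l`, and the other stacks are empty. -/
noncomputable def pda (P : StackProgram C K Γ) (c : C) (k₀ : K) (l : List Γ) :
    OmegaPDA (Option Γ) (Option (Option (K × C))) (Option Γ) where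
  start := none
  bottom := none
  trans := (none, none, none, some (some (k₀, c)), marked l) :: P.fixedTrans c k₀
  acc := {{some none}}

theorem mem_trans_pda_none {P : StackProgram C K Γ} {c : C} {k₀ : K} {l : List Γ}
    {a : Option (Option Γ)} {X : Option Γ} {q : Option (Option (K × C))} {v : List (Option Γ)} :
    (none, a, X, q, v) ∈ (P.pda c k₀ l).trans ↔
      ∃ k, a = none ∧ X = none ∧ q = some (some (k, c)) ∧
        v = marked (Function.update (fun _ => []) k₀ l k) := by
  simp only [pda, fixedTrans, List.mem_cons, List.mem_append, List.mem_map, Finset.mem_toList,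
    Finset.mem_erase, Finset.mem_univ, Prod.mk.injEq, reduceCtorEq, false_and, and_false,
    exists_false, or_false, true_and, and_true]
  constructor
  · rintro (⟨rfl, rfl, rfl, rfl⟩ | ⟨k, hk, rfl, rfl, rfl, rfl⟩)
    · exact ⟨k₀, by simp⟩
    · exact ⟨k, by simp [hk, marked]⟩
  · rintro ⟨k, rfl, rfl, rfl, rfl⟩
    by_cases hk : k = k₀
    · subst hk; simp
    · exact Or.inr ⟨k, hk, by simp [hk, marked]⟩

theorem mem_trans_pda_some {P : StackProgram C K Γ} {c : C} {k₀ : K} {l : List Γ}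
    {p : Option (K × C)} {a : Option (Option Γ)} {X : Option Γ} {q : Option (Option (K × C))}
    {v : List (Option Γ)} :
    (some p, a, X, q, v) ∈ (P.pda c k₀ l).trans ↔
      ∃ s, a = some s ∧ q = some (P.track p s X).1 ∧ v = (P.track p s X).2 := by
  simp only [pda, fixedTrans, List.mem_cons, List.mem_append, List.mem_map, Finset.mem_toList,
    Finset.mem_univ, Prod.mk.injEq, reduceCtorEq, false_and, and_false,
    exists_false, false_or, true_and, Prod.exists, Option.some.injEq]
  constructor
  · rintro ⟨p, s, X, rfl, rfl, rfl, rfl, rfl⟩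
    exact ⟨s, rfl, rfl, rfl⟩
  · rintro ⟨s, rfl, rfl, rfl⟩
    exact ⟨p, s, X, rfl, rfl, rfl, rfl, rfl⟩

/-- The first move is the `ε`-move that makes the guess; every later move reads a letter, whence the
position `i - 1`. -/
theorem isRun_pda_trackRun (P : StackProgram C K Γ) (c : C) (k₀ : K) (l : List Γ)
    (w : ℕ → Option Γ) (k : K) :
    (P.pda c k₀ l).IsRun w
      (fun i => i.casesOn none fun j =>
        some (P.trackRun (c, Function.update (fun _ => []) k₀ l) w k j).1)
      (fun i => i.casesOn [none] fun j =>
        (P.trackRun (c, Function.update (fun _ => []) k₀ l) w k j).2)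
      (fun i => i - 1) where
  init_state := rfl
  init_stack := rfl
  init_pos := rfl
  step i := by
    cases i with
    | zero =>
      exact ⟨none, none, _, [], mem_trans_pda_none.2 ⟨k, rfl, rfl, rfl, rfl⟩, rfl,
        by simp [trackRun], by simp⟩
    | succ j =>
      obtain ⟨t, r, h⟩ := P.trackRun_eq_cons (c, Function.update (fun _ => []) k₀ l) w k j
      refine ⟨some (w j), t, _, r, mem_trans_pda_some.2 ⟨w j, rfl, ?_, rfl⟩, ?_, ?_, by simp⟩
      · simp only [trackRun]; rw [h]; rfl
      · simp only; rw [h]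
      · simp only [trackRun]; rw [h]; rfl
  complete n := ⟨n + 1, by simp⟩

/-- Nondeterminism is confined to the first move; `track` determines the rest. -/
theorem eq_trackRun_of_isRun {P : StackProgram C K Γ} {c : C} {k₀ : K} {l : List Γ}
    {w : ℕ → Option Γ} {q : ℕ → Option (Option (K × C))} {s : ℕ → List (Option Γ)} {p : ℕ → ℕ}
    (h : (P.pda c k₀ l).IsRun w q s p) :
    ∃ k, ∀ i, q (i + 1) =
      some (P.trackRun (c, Function.update (fun _ => []) k₀ l) w k i).1 := by
  obtain ⟨a, X, v, r, hmem, hs, hs', hp⟩ := h.step 0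
  rw [show q 0 = none from h.init_state] at hmem
  obtain ⟨k, rfl, rfl, hq, rfl⟩ := mem_trans_pda_none.1 hmem
  rw [show s 0 = [none] from h.init_stack] at hs
  obtain rfl : r = [] := by simpa using hs.symm
  suffices ∀ i, q (i + 1) =
      some (P.trackRun (c, Function.update (fun _ => []) k₀ l) w k i).1 ∧
      s (i + 1) = (P.trackRun (c, Function.update (fun _ => []) k₀ l) w k i).2 ∧
      p (i + 1) = i from ⟨k, fun i => (this i).1⟩
  intro i
  induction i with
  | zero => exact ⟨hq, by simpa [trackRun] using hs', by simpa [h.init_pos] using hp⟩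
  | succ i ih =>
    obtain ⟨ih1, ih2, ih3⟩ := ih
    obtain ⟨a, X, v, r, hmem, hs, hs', hp⟩ := h.step (i + 1)
    rw [ih1] at hmem
    obtain ⟨b, rfl, hq, rfl⟩ := mem_trans_pda_some.1 hmem
    simp only [reduceCtorEq, false_and, Option.some.injEq, false_or, ih3] at hp
    obtain ⟨rfl, hp⟩ := hp
    rw [ih2] at hs
    rw [trackRun, show P.trackRun (c, Function.update (fun _ => []) k₀ l) w k i =
      ((P.trackRun (c, Function.update (fun _ => []) k₀ l) w k i).1, X :: r) from
        Prod.ext rfl hs]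
    exact ⟨hq, hs', hp⟩

theorem mem_language_pda_iff {P : StackProgram C K Γ} {c : C} {k₀ : K} {l : List Γ}
    {m : AccMode} {w : ℕ → Option Γ} :
    w ∈ (P.pda c k₀ l).language m ↔
      ∃ k i, (P.trackRun (c, Function.update (fun _ => []) k₀ l) w k i).1 = none := by
  constructor
  · rintro ⟨q, s, p, hrun, hacc⟩
    have hinf : some none ∈ OmegaPDA.infStates q := by
      cases m with
      | buchi => obtain ⟨H, rfl, x, hx, rfl⟩ := hacc; exact hx
      | muller => rw [show OmegaPDA.infStates q = {some none} from hacc]; rfl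
    obtain ⟨k, hk⟩ := eq_trackRun_of_isRun hrun
    -- The bound `1` skips the initial state, which precedes the tracking run.
    obtain ⟨i, hi, hq⟩ := hinf 1
    obtain ⟨j, rfl⟩ := Nat.exists_eq_add_of_le' hi
    rw [hk] at hq
    exact ⟨k, j, Option.some_injective _ hq⟩
  · rintro ⟨k, i, hi⟩
    refine ⟨_, _, _, P.isRun_pda_trackRun c k₀ l w k, ?_⟩
    -- The sink is never left, so it is the only state visited infinitely often, which suits both
    -- modes.
    have hinf : OmegaPDA.infStates (fun i : ℕ => (i.casesOn none fun j =>
        some (P.trackRun (c, Function.update (fun _ => []) k₀ l) w k j).1 :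
          Option (Option (K × C)))) = {some none} := by
      ext y
      constructor
      · intro hy
        obtain ⟨j, hj, rfl⟩ := hy (i + 1)
        obtain ⟨j, rfl⟩ := Nat.exists_eq_add_of_le' (le_trans (Nat.le_add_left 1 i) hj)
        exact congrArg some (P.trackRun_of_le _ w k (by omega) hi)
      · rintro rfl n
        exact ⟨n + i + 1, by omega, congrArg some (P.trackRun_of_le _ w k (by omega) hi)⟩
    cases m with
    | buchi => exact ⟨_, rfl, some none, by rw [hinf]; rfl, rfl⟩
    | muller => exact hinf

theorem language_pda_eq_univ_iff {P : StackProgram C K Γ} {c : C} {k₀ : K} {l : List Γ}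
    {m : AccMode} :
    (P.pda c k₀ l).language m = Set.univ ↔
      (StateTransition.eval P.step (c, Function.update (fun _ => []) k₀ l)).Dom := by
  have : Nonempty K := ⟨k₀⟩
  rw [← forall_exists_trackRun_iff, Set.eq_univ_iff_forall]
  simp only [mem_language_pda_iff]

end StackProgram

/-! ### Invariance under renaming and numerical descriptions -/

namespace OmegaPDA

variable {A A' Q Q' Γ Γ' : Type}

/-- Renaming letters, states and stack symbols turns runs into runs. -/
theorem IsRun.map {M : OmegaPDA A Q Γ} {M' : OmegaPDA A' Q' Γ'} {gA : A → A'} {gQ : Q → Q'}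
    {gΓ : Γ → Γ'} (hstart : M'.start = gQ M.start) (hbottom : M'.bottom = gΓ M.bottom)
    (htrans : ∀ q a X q' v, (q, a, X, q', v) ∈ M.trans →
      (gQ q, a.map gA, gΓ X, gQ q', v.map gΓ) ∈ M'.trans)
    {α : ℕ → A} {q : ℕ → Q} {s : ℕ → List Γ} {p : ℕ → ℕ} (h : M.IsRun α q s p) :
    M'.IsRun (gA ∘ α) (gQ ∘ q) (fun i => (s i).map gΓ) p where
  init_state := by simp [h.init_state, hstart]
  init_stack := by simp [h.init_stack, hbottom]
  init_pos := h.init_pos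
  step i := by
    obtain ⟨a, X, v, r, hmem, hs, hs', hp⟩ := h.step i
    refine ⟨_, _, _, r.map gΓ, htrans _ _ _ _ _ hmem, by simp [hs], by simp [hs'], ?_⟩
    rcases hp with ⟨rfl, hp⟩ | ⟨rfl, hp⟩
    · exact Or.inl ⟨rfl, hp⟩
    · exact Or.inr ⟨rfl, hp⟩
  complete := h.complete

theorem infStates_comp (e : Q ≃ Q') (q : ℕ → Q) :
    infStates (e ∘ q) = e '' infStates q := by
  ext x
  simp [infStates, Equiv.image_eq_preimage_symm, Equiv.eq_symm_apply]

theorem language_of_equiv {M : OmegaPDA A Q Γ} {M' : OmegaPDA A' Q' Γ'} (eA : A ≃ A')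
    (eQ : Q ≃ Q') (eΓ : Γ ≃ Γ') (hstart : M'.start = eQ M.start)
    (hbottom : M'.bottom = eΓ M.bottom)
    (htrans : M'.trans = M.trans.map fun t =>
      (eQ t.1, t.2.1.map eA, eΓ t.2.2.1, eQ t.2.2.2.1, t.2.2.2.2.map eΓ))
    (hacc : M'.acc = (eQ '' ·) '' M.acc) (m : AccMode) (α : ℕ → A) :
    eA ∘ α ∈ M'.language m ↔ α ∈ M.language m := by
  have hacc' : ∀ q, m.Accepts M'.acc (eQ ∘ q) ↔ m.Accepts M.acc q := by
    intro q
    cases m with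
    | buchi =>
      simp only [AccMode.Accepts, hacc, Set.exists_mem_image, infStates_comp,
        ← Set.image_inter eQ.injective, Set.image_nonempty]
    | muller =>
      simp only [AccMode.Accepts, hacc, infStates_comp]
      exact (Set.image_injective.2 eQ.injective).mem_set_image
  constructor
  · rintro ⟨q, s, p, hrun, h⟩
    refine ⟨eQ.symm ∘ q, fun i => (s i).map eΓ.symm, p, ?_, ?_⟩
    · have := hrun.map (M' := M) (gA := eA.symm) (gQ := eQ.symm) (gΓ := eΓ.symm)
        (by simp [hstart]) (by simp [hbottom]) ?_
      · simpa [← Function.comp_assoc] using this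
      · intro q a X q' v hmem
        rw [htrans, List.mem_map] at hmem
        obtain ⟨t, ht, h⟩ := hmem
        simp only [Prod.mk.injEq] at h
        obtain ⟨rfl, rfl, rfl, rfl, rfl⟩ := h
        simpa using ht
    · rw [← hacc', ← Function.comp_assoc]
      simpa using h
  · rintro ⟨q, s, p, hrun, h⟩
    refine ⟨_, _, p, hrun.map (M' := M') (gA := eA) (gQ := eQ) (gΓ := eΓ) hstart hbottom ?_,
      (hacc' q).2 h⟩
    intro q a X q' v hmem
    rw [htrans]
    exact List.mem_map_of_mem hmem

end OmegaPDA

namespace PDACode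

theorem ofNat_coe {n : ℕ} (x : Fin (n + 1)) : Fin.ofNat (n + 1) (x : ℕ) = x :=
  Fin.ext (Nat.mod_eq_of_lt x.2)

variable {A Q Γ : Type} {a n s : ℕ}

/-- The description of a transition, with a single output letter. -/
def ofTrans (eA : A ≃ Fin (a + 1)) (eQ : Q ≃ Fin (n + 1)) (eΓ : Γ ≃ Fin (s + 1))
    (t : Q × Option A × Γ × Q × List Γ) : ℕ × Option (ℕ × ℕ) × ℕ × ℕ × List ℕ :=
  (eQ t.1, t.2.1.map fun x => ((eA x : ℕ), 0), eΓ t.2.2.1, eQ t.2.2.2.1,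
    t.2.2.2.2.map fun X => (eΓ X : ℕ))

/-- The description of an automaton, with a single output letter and a single designated state. -/
def ofPDA (M : OmegaPDA A Q Γ) (x : Q) (eA : A ≃ Fin (a + 1)) (eQ : Q ≃ Fin (n + 1))
    (eΓ : Γ ≃ Fin (s + 1)) : PDACode where
  lettersI := a
  lettersO := 0
  states := n
  stackSyms := s
  start := eQ M.start
  bottom := eΓ M.bottom
  trans := M.trans.map (ofTrans eA eQ eΓ)
  acc := [[(eQ x : ℕ)]]

theorem language_ofPDA_eq_univ_iff {M : OmegaPDA A Q Γ} {x : Q} (hx : M.acc = {{x}})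
    (eA : A ≃ Fin (a + 1)) (eQ : Q ≃ Fin (n + 1)) (eΓ : Γ ≃ Fin (s + 1)) (m : AccMode) :
    (ofPDA M x eA eQ eΓ).language m = Set.univ ↔ M.language m = Set.univ := by
  let e : A ≃ Fin (a + 1) × Fin 1 := eA.trans (Equiv.prodUnique _ _).symm
  have h : ∀ α, e ∘ α ∈ (ofPDA M x eA eQ eΓ).language m ↔ α ∈ M.language m := by
    refine OmegaPDA.language_of_equiv (M' := (ofPDA M x eA eQ eΓ).toPDA) e eQ eΓ ?_ ?_ ?_ ?_ m
    · exact ofNat_coe (eQ M.start)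
    · exact ofNat_coe (eΓ M.bottom)
    · simp only [toPDA, ofPDA, ofTrans, List.map_map, Option.map_map, Function.comp_def, ofNat_coe]
      rfl
    · ext H
      simp only [toPDA, ofPDA, hx, ofNat_coe, List.mem_singleton, exists_eq_left,
        Set.image_singleton]
      simp only [eq_comm]
      rfl
  simp only [Set.eq_univ_iff_forall]
  refine ⟨fun H α => (h α).1 (H _), fun H α => ?_⟩
  rw [show α = e ∘ e.symm ∘ α from funext fun i => (e.apply_symm_apply (α i)).symm]
  exact (h _).2 (H _)

end PDACode

/-! ### Simulation of `TM2` machines by stack programs -/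

namespace StackProgram

open Turing StateTransition

section TM2

variable {K Γ Λ σ T : Type}

/-- The program that executes a machine of type `TM2` statement by statement. Its control points
consist of a name of the next statement and the value of the internal variable. -/
def ofTM2 (M : Λ → TM2.Stmt (fun _ : K => Γ) Λ σ)
    (code : Option (TM2.Stmt (fun _ : K => Γ) Λ σ) → T)
    (decode : T → Option (TM2.Stmt (fun _ : K => Γ) Λ σ)) (k₀ : K) :
    StackProgram (T × σ) K Γ :=
  fun c =>
    match decode c.1 with
    | none => none
    | some (.push k f q) => some (k, fun s => ((code (some q), c.2), f c.2 :: s.toList))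
    | some (.peek k f q) => some (k, fun s => ((code (some q), f c.2 s), s.toList))
    | some (.pop k f q) => some (k, fun s => ((code (some q), f c.2 s), []))
    -- A program step must observe some stack; statements that use none observe `k₀` and restore its
    -- top.
    | some (.load f q) => some (k₀, fun s => ((code (some q), f c.2), s.toList))
    | some (.branch f q₁ q₂) =>
      some (k₀, fun s => ((code (some (cond (f c.2) q₁ q₂)), c.2), s.toList))
    | some (.goto f) => some (k₀, fun s => ((code (some (M (f c.2))), c.2), s.toList))
    | some .halt => some (k₀, fun s => ((code none, c.2), s.toList))

theorem toList_head?_append_tail {X : Type} (l : List X) : l.head?.toList ++ l.tail = l := by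
  cases l <;> rfl

variable {M : Λ → TM2.Stmt (fun _ : K => Γ) Λ σ}
  {code : Option (TM2.Stmt (fun _ : K => Γ) Λ σ) → T}
  {decode : T → Option (TM2.Stmt (fun _ : K => Γ) Λ σ)} {S : Finset Λ}

theorem some_mem_stmts {l : Λ} (hl : l ∈ S) : some (M l) ∈ TM2.stmts M S := by
  simp only [TM2.stmts, Finset.some_mem_insertNone, Finset.mem_biUnion]
  exact ⟨l, hl, TM2.stmts₁_self⟩

theorem none_mem_stmts : none ∈ TM2.stmts M S := by
  simp [TM2.stmts]

variable [DecidableEq K]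

/-- One machine step runs a whole statement, the program one constructor at a time, hence
`Reaches₁`. Only substatements in the finite set `TM2.stmts M S` need names, which keeps the control
finite. -/
theorem reaches_stepAux (hcode : ∀ q ∈ TM2.stmts M S, decode (code q) = q) (k₀ : K)
    (q : TM2.Stmt (fun _ : K => Γ) Λ σ) (hq : some q ∈ TM2.stmts M S)
    (hS : TM2.SupportsStmt S q) (v : σ) (stk : K → List Γ) (t : T) (ht : decode t = some q) :
    (∀ l ∈ (TM2.stepAux q v stk).l, l ∈ S) ∧
      ∃ t', decode t' = (TM2.stepAux q v stk).l.map M ∧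
        Reaches₁ (ofTM2 M code decode k₀).step ((t, v), stk)
          ((t', (TM2.stepAux q v stk).var), (TM2.stepAux q v stk).stk) := by
  -- The common inductive step: one program step, followed by the run for the remaining statement.
  have next : ∀ {v stk t} {q' : TM2.Stmt (fun _ : K => Γ) Λ σ} {v' stk' r},
      decode (code (some q')) = some q' →
      ((code (some q'), v'), stk') ∈ (ofTM2 M code decode k₀).step ((t, v), stk) →
      (∀ v stk t, decode t = some q' → (∀ l ∈ (TM2.stepAux q' v stk).l, l ∈ S) ∧
        ∃ t', decode t' = (TM2.stepAux q' v stk).l.map M ∧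
          Reaches₁ (ofTM2 M code decode k₀).step ((t, v), stk)
            ((t', (TM2.stepAux q' v stk).var), (TM2.stepAux q' v stk).stk)) →
      r = TM2.stepAux q' v' stk' →
      (∀ l ∈ r.l, l ∈ S) ∧ ∃ t', decode t' = r.l.map M ∧
        Reaches₁ (ofTM2 M code decode k₀).step ((t, v), stk) ((t', r.var), r.stk) := by
    rintro v stk t q' v' stk' r h hstep ih rfl
    obtain ⟨h1, t', ht', h2⟩ := ih v' stk' _ h
    exact ⟨h1, t', ht', h2.head hstep⟩
  induction q generalizing v stk t with
  | push k f q ih =>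
    have hq' : some q ∈ TM2.stmts M S := TM2.stmts_trans (by simp [TM2.stmts₁, TM2.stmts₁_self]) hq
    refine next (hcode _ hq') ?_ (ih hq' hS) rfl
    simp [ofTM2, step, ht, toList_head?_append_tail]
  | peek k f q ih =>
    have hq' : some q ∈ TM2.stmts M S := TM2.stmts_trans (by simp [TM2.stmts₁, TM2.stmts₁_self]) hq
    refine next (hcode _ hq') ?_ (ih hq' hS) rfl
    simp [ofTM2, step, ht, toList_head?_append_tail]
  | pop k f q ih =>
    have hq' : some q ∈ TM2.stmts M S := TM2.stmts_trans (by simp [TM2.stmts₁, TM2.stmts₁_self]) hq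
    refine next (hcode _ hq') ?_ (ih hq' hS) rfl
    simp [ofTM2, step, ht]
  | load f q ih =>
    have hq' : some q ∈ TM2.stmts M S := TM2.stmts_trans (by simp [TM2.stmts₁, TM2.stmts₁_self]) hq
    refine next (hcode _ hq') ?_ (ih hq' hS) rfl
    simp [ofTM2, step, ht, toList_head?_append_tail]
  | branch f q₁ q₂ ih₁ ih₂ =>
    have hq₁ : some q₁ ∈ TM2.stmts M S :=
      TM2.stmts_trans (by simp [TM2.stmts₁, TM2.stmts₁_self]) hq
    have hq₂ : some q₂ ∈ TM2.stmts M S :=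
      TM2.stmts_trans (by simp [TM2.stmts₁, TM2.stmts₁_self]) hq
    cases hf : f v with
    | true =>
      refine next (v' := v) (stk' := stk) (hcode _ hq₁) ?_ (ih₁ hq₁ hS.1) (by simp [hf])
      simp [ofTM2, step, ht, toList_head?_append_tail, hf]
    | false =>
      refine next (v' := v) (stk' := stk) (hcode _ hq₂) ?_ (ih₂ hq₂ hS.2) (by simp [hf])
      simp [ofTM2, step, ht, toList_head?_append_tail, hf]
  | goto f =>
    refine ⟨by simpa using hS v, code (some (M (f v))), hcode _ (some_mem_stmts (hS v)), .single ?_⟩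
    simp [ofTM2, step, ht, toList_head?_append_tail]
  | halt =>
    refine ⟨by simp, code none, hcode _ none_mem_stmts, .single ?_⟩
    simp [ofTM2, step, ht, toList_head?_append_tail]

theorem eval_ofTM2_dom_iff (hcode : ∀ q ∈ TM2.stmts M S, decode (code q) = q) (k₀ : K)
    (hS : ∀ l ∈ S, TM2.SupportsStmt S (M l)) {l : Λ} (hl : l ∈ S) (v : σ) (stk : K → List Γ) :
    (eval (ofTM2 M code decode k₀).step ((code (some (M l)), v), stk)).Dom ↔
      (eval (TM2.step M) ⟨some l, v, stk⟩).Dom := by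
  refine tr_eval_dom (tr := fun (a : TM2.Cfg (fun _ : K => Γ) Λ σ) (b : (T × σ) × (K → List Γ)) =>
    (∀ l ∈ a.l, l ∈ S) ∧ decode b.1.1 = a.l.map M ∧ b.1.2 = a.var ∧ b.2 = a.stk) ?_ ?_
  · rintro ⟨l, v, stk⟩ ⟨⟨t, v'⟩, stk'⟩ ⟨hl, ht, rfl, rfl⟩
    cases l with
    | none => simpa [step, ofTM2] using by simp_all
    | some l =>
      have hl := hl l rfl
      obtain ⟨h1, t', ht', h2⟩ :=
        reaches_stepAux hcode k₀ (M l) (some_mem_stmts hl) (hS l hl) v' stk' t ht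
      exact ⟨_, ⟨h1, ht', rfl, rfl⟩, h2⟩
  · exact ⟨by simpa using hl, hcode _ (some_mem_stmts hl), rfl, rfl⟩

end TM2

end StackProgram

/-! ### Undecidability of halting and computability of the reduction -/

open Turing Turing.PartrecToTM2

theorem primrec_bits : Primrec Nat.bits := by
  have h : Primrec₂ fun (_ : Unit) n => Nat.bits n := by
    -- The list `l` holds the values below `n`, so `l.length` is `n`; the bits of `n` are its parity
    -- followed by the bits of `n / 2`.
    refine Primrec.nat_strong_rec _ (g := fun _ l =>
      if l.length = 0 then some []
      else l[l.length / 2]?.map fun r => decide (l.length % 2 = 1) :: r) ?_ ?_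
    · have hl : Primrec fun p : Unit × List (List Bool) => p.2.length :=
        Primrec.list_length.comp Primrec.snd
      refine Primrec.ite (Primrec.eq.comp hl (Primrec.const 0)) (Primrec.const _) ?_
      refine Primrec.option_map (Primrec.list_getElem?.comp Primrec.snd
        (Primrec.nat_div.comp hl (Primrec.const 2))) ?_
      exact Primrec.list_cons.comp (PrimrecPred.decide (Primrec.eq.comp
        (Primrec.nat_mod.comp (hl.comp Primrec.fst) (Primrec.const 2)) (Primrec.const 1)))
        Primrec.snd
    · rintro - n
      rcases Nat.eq_zero_or_pos n with rfl | hn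
      · simp
      · have h2 : n / 2 < n := Nat.div_lt_self hn one_lt_two
        simp only [List.length_map, List.length_range, hn.ne', if_false, List.getElem?_map,
          List.getElem?_range h2, Option.map_some, Option.some.injEq]
        rcases Nat.even_or_odd' n with ⟨k, rfl | rfl⟩
        · rw [Nat.bit0_bits k (by omega)]; simp
        · rw [Nat.bit1_bits, show (2 * k + 1) / 2 = k by omega]; simp
  exact h.comp (Primrec.const ()) Primrec.id

theorem trNat_eq_map_bits (n : ℕ) :
    trNat n = n.bits.map fun b => cond b Γ'.bit1 Γ'.bit0 := by
  have h : ∀ p : PosNum, trPosNum p = (p : ℕ).bits.map fun b => cond b Γ'.bit1 Γ'.bit0 := by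
    intro p
    induction p with
    | one => simp [trPosNum]
    | bit0 p ih =>
      rw [trPosNum, ih, PosNum.cast_bit0, ← two_mul, Nat.bit0_bits _ (PosNum.cast_pos p).ne']
      rfl
    | bit1 p ih =>
      rw [trPosNum, ih, PosNum.cast_bit1, ← two_mul, Nat.bit1_bits]
      rfl
  rw [trNat]
  conv_rhs => rw [← Num.to_of_nat n]
  cases (n : Num) with
  | zero => simp [trNum]
  | pos p => exact h p

/-- `c` is universal: on `n` it runs the `n`-th partial recursive code on input `0`. -/
theorem exists_code_not_computablePred :
    ∃ c : ToPartrec.Code, ¬ ComputablePred fun n : ℕ => (c.eval [n]).Dom := by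
  let f : ℕ →. ℕ := fun n => Nat.Partrec.Code.eval (Denumerable.ofNat Nat.Partrec.Code n) 0
  have hf : Partrec f :=
    Nat.Partrec.Code.eval_part.comp (Computable.ofNat _) (Computable.const 0)
  obtain ⟨c, hc⟩ := ToPartrec.Code.exists_code (Nat.Partrec'.part_iff₁.2 hf)
  refine ⟨c, fun h => ComputablePred.halting_problem 0
    (ComputablePred.computable_of_manyOneReducible ⟨_, Computable.encode, fun d => ?_⟩ h)⟩
  have := hc (Encodable.encode d ::ᵥ List.Vector.nil)
  rw [show c.eval [Encodable.encode d] = _ from this]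
  simp [f]

theorem exists_equiv_fin_succ (X : Type) [Finite X] [Nonempty X] :
    ∃ n, Nonempty (X ≃ Fin (n + 1)) := by
  obtain ⟨n, ⟨e⟩⟩ := Finite.exists_equiv_fin X
  cases n with
  | zero => exact (e (Classical.arbitrary X)).elim0
  | succ n => exact ⟨n, ⟨e⟩⟩

instance : Finite K' :=
  Finite.of_surjective (fun i : Fin 4 => ![K'.main, .rev, .aux, .stack] i) fun k => by
    cases k
    exacts [⟨0, rfl⟩, ⟨1, rfl⟩, ⟨2, rfl⟩, ⟨3, rfl⟩]

theorem exists_stackProgram (c : ToPartrec.Code) :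
    ∃ (C : Type) (_ : Finite C) (P : StackProgram C K' Γ') (x : C), ∀ n : ℕ,
      (StateTransition.eval P.step
        (x, Function.update (fun _ => []) K'.main (trList [n]))).Dom ↔ (c.eval [n]).Dom := by
  classical
  let M : Λ' → TM2.Stmt (fun _ : K' => Γ') Λ' (Option Γ') := tr
  let S : Finset Λ' := codeSupp c Cont'.halt
  have hS : @TM2.Supports _ _ _ _ ⟨trNormal c Cont'.halt⟩ M S := tr_supports c Cont'.halt
  let T : Type := TM2.stmts M S
  -- Statements outside the support get a junk name; it is never used.
  let code : Option (TM2.Stmt (fun _ : K' => Γ') Λ' (Option Γ')) → T := fun q =>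
    if h : q ∈ TM2.stmts M S then ⟨q, h⟩ else ⟨none, StackProgram.none_mem_stmts⟩
  have hcode : ∀ q ∈ TM2.stmts M S, (code q : Option _) = q := fun q hq => by simp [code, hq]
  refine ⟨T × Option Γ', inferInstance, StackProgram.ofTM2 M code (fun t => t.1) K'.main,
    (code (some (M (trNormal c Cont'.halt))), none), fun n => ?_⟩
  have hl : trNormal c Cont'.halt ∈ S := hS.1
  refine (StackProgram.eval_ofTM2_dom_iff hcode K'.main hS.2 hl none _).trans ?_
  have h := tr_eval c [n]
  rw [show init c [n] = ⟨some (trNormal c Cont'.halt), none,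
    Function.update (fun _ => []) K'.main (trList [n])⟩ from ?_] at h
  · rw [show StateTransition.eval (TM2.step M) _ = _ from h]
    simp
  · rw [init]
    congr 1
    funext k
    cases k <;> rfl

/-- The numberings and the fixed transitions are chosen noncomputably but do not depend on `n`, so
they are constants of the reduction. -/
theorem exists_computable_pdaCode (c : ToPartrec.Code) :
    ∃ g : ℕ → PDACode, Computable g ∧ ∀ n, (g n).lettersO = 0 ∧
      ∀ m, (g n).language m = Set.univ ↔ (c.eval [n]).Dom := by
  classical
  obtain ⟨C, _, P, x, hP⟩ := exists_stackProgram c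
  have := Fintype.ofFinite C
  have := Fintype.ofFinite K'
  obtain ⟨a, ⟨eΓ⟩⟩ := exists_equiv_fin_succ (Option Γ')
  obtain ⟨b, ⟨eQ⟩⟩ := exists_equiv_fin_succ (Option (Option (K' × C)))
  refine ⟨fun n => PDACode.ofPDA (P.pda x K'.main (trList [n])) (some none) eΓ eQ eΓ, ?_,
    fun n => ⟨rfl, fun m => ?_⟩⟩
  · let fixed := (P.fixedTrans x K'.main).map (PDACode.ofTrans eΓ eQ eΓ)
    -- The encoded initial stack: the binary digits of `n`, the separator `Γ'.cons`, and the bottom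
    -- marker.
    let word : ℕ → List ℕ := fun n =>
      n.bits.map (fun b => cond b (eΓ (some Γ'.bit1) : ℕ) (eΓ (some Γ'.bit0))) ++
        [(eΓ (some Γ'.cons) : ℕ), eΓ none]
    have hword : Primrec word := Primrec.list_append.comp
      (Primrec.list_map primrec_bits
        (Primrec.cond Primrec.snd (Primrec.const _) (Primrec.const _))) (Primrec.const _)
    have hfirst : Primrec fun n => ((eQ none : ℕ), (none : Option (ℕ × ℕ)), (eΓ none : ℕ),
        (eQ (some (some (K'.main, x))) : ℕ), word n) :=
      (Primrec.const _).pair ((Primrec.const _).pair ((Primrec.const _).pair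
        ((Primrec.const _).pair hword)))
    have hcode : Primrec fun n => PDACode.equivTuple.symm
        (a, 0, b, a, (eQ none : ℕ), (eΓ none : ℕ), ((eQ none : ℕ), (none : Option (ℕ × ℕ)),
          (eΓ none : ℕ), (eQ (some (some (K'.main, x))) : ℕ), word n) :: fixed,
          [[(eQ (some none) : ℕ)]]) := by
      refine (Primrec.of_equiv_symm (e := PDACode.equivTuple)).comp ?_
      exact (Primrec.const _).pair ((Primrec.const _).pair ((Primrec.const _).pair
        ((Primrec.const _).pair ((Primrec.const _).pair ((Primrec.const _).pair
          ((Primrec.list_cons.comp hfirst (Primrec.const _)).pair (Primrec.const _)))))))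
    refine (hcode.of_eq fun n => ?_).to_comp
    simp [PDACode.equivTuple, PDACode.ofPDA, StackProgram.pda, PDACode.ofTrans, word, fixed,
      StackProgram.marked, trNat_eq_map_bits, Bool.apply_cond]
  · rw [PDACode.language_ofPDA_eq_univ_iff rfl, StackProgram.language_pda_eq_univ_iff]
    exact hP n

end DelayGames

theorem mainTheorem8 (m : DelayGames.AccMode) :
    (¬ ComputablePred fun c : DelayGames.PDACode =>
        DelayGames.HasOmnipotentLC (c.language m)) ∧
    (¬ ComputablePred fun c : DelayGames.PDACode =>
        DelayGames.HasOmnipotentIOT (c.language m)) ∧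
    (¬ ComputablePred fun c : DelayGames.PDACode =>
        DelayGames.HasOmnipotentHT (c.language m)) ∧
    (¬ ComputablePred fun c : DelayGames.PDACode =>
        DelayGames.HasOmnipotentRC (c.language m)) := by
  obtain ⟨c, hc⟩ := DelayGames.exists_code_not_computablePred
  obtain ⟨g, hg, hgc⟩ := DelayGames.exists_computable_pdaCode c
  have unique : ∀ n, Nonempty (Unique (g n).SigmaO) := fun n => by
    rw [DelayGames.PDACode.SigmaO, (hgc n).1]
    exact ⟨(inferInstance : Unique (Fin 1))⟩
  have neg : ∀ p : DelayGames.PDACode → Prop,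
      (∀ n, p (g n) ↔ (g n).language m ≠ Set.univ) → ¬ ComputablePred p := fun p hp h =>
    hc ((ComputablePred.computable_of_manyOneReducible ⟨g, hg, fun _ => Iff.rfl⟩ h).not.of_eq
      fun n => by rw [hp, not_not, (hgc n).2])
  have pos : ∀ p : DelayGames.PDACode → Prop,
      (∀ n, p (g n) ↔ (g n).language m = Set.univ) → ¬ ComputablePred p := fun p hp h =>
    hc ((ComputablePred.computable_of_manyOneReducible ⟨g, hg, fun _ => Iff.rfl⟩ h).of_eq
      fun n => by rw [hp, (hgc n).2])
  refine ⟨neg _ fun n => ?_, neg _ fun n => ?_, neg _ fun n => ?_, pos _ fun n => ?_⟩ <;>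
    obtain ⟨_⟩ := unique n
  exacts [DelayGames.hasOmnipotentLC_iff, DelayGames.hasOmnipotentIOT_iff,
    DelayGames.hasOmnipotentHT_iff, DelayGames.hasOmnipotentRC_iff]
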